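/- Throughout, $K=(K,\prec)$ is an abstract elementary class (AEC) in a language $L$, with Löwenheim–Skolem number $LS(K)$, and $\|M\|$ is the cardinality of the universe of $M$. A *$K$-embedding* $f:M\to N$ is an $L$-embedding with $f(M)\prec N$. **Galois types.** A pretype over $M\in K$ with index set $I$ is a triple $(\langle a_i:i\in I\rangle,M,N)$ with $M\prec N\in K$ and all $a_i\in N$. Put $(\langle a_i\rangle,M,N)\sim_{AT}(\langle b_i\rangle,M,N')$ if there are $N^*\in K$ and $K$-embeddings $f:N\to N^*$, $g:N'\to N^*$ that agree on $M$ and satisfy $f(a_i)=g(b_i)$ for all $i\in I$; let $\sim$ be the transitive closure of $\sim_{AT}$. Then $S^I(M)$ is the set of $\sim$-classes of pretypes over $M$ with index set $I$. If $p\in S^I(M)$ is the class of $(\langle a_i:i\in I\rangle,M,N)$, $J\subseteq I$ and $M_0\prec M$, then $p^J\in S^J(M)$ is the class of $(\langle a_i:i\in J\rangle,M,N)$ and $p\restriction M_0\in S^I(M_0)$ is the class of $(\langle a_i:i\in I\rangle,M_0,N)$. **Hypotheses on $K$ and $\kappa$.** The cardinal $\kappa$ is *measurable* if it is uncountable and carries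 a nonprincipal $\kappa$-complete ultrafilter. $K$ is *essentially below* $\kappa$ if either $LS(K)<\kappa$, or $K=(\mathrm{Mod}\,T,\prec_{\mathcal F})$ for some $L_{\kappa,\omega}$-theory $T$ and some fragment $\mathcal F$ of $L_{\kappa,\omega}$. $K$ *has a monster model* if for every cardinal $\mu$ there is $\mathfrak C\in K$ whose cardinality and whose cofinality of the cardinality are at least $\mu$, such that every $N\in K$ with $\|N\|<\mu$ has a $K$-embedding into $\mathfrak C$ and, whenever $M\prec\mathfrak C$ and $M\prec N\in K$ with $\|N\|<\mu$, there is a $K$-embedding of $N$ into $\mathfrak C$ that fixes $M$ pointwise. **Theorem.** Let $\kappa$ be measurable and let $K$ be an AEC that is essentially below $\kappa$ and has a monster model. 1. Let $M=\bigcup_{\alpha<\kappa}M_\alpha$ for a $\prec$-increasing sequence $\langle M_\alpha:\alpha<\kappa\rangle$ of members of $K$ (not necessarily continuous), and let $I=\bigcup_{\alpha<\kappa}I_\alpha$ for a $\subseteq$-increasing sequence $\langle I_\alpha:\alpha<\kappa\rangle$. If $p\ne q$ are in $S^I(M)$, then there is $\alpha_0<\kappa$ such that $M_{\alpha_0}\prec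 M$ and $p^{I_{\alpha_0}}\restriction M_{\alpha_0}\neq q^{I_{\alpha_0}}\restriction M_{\alpha_0}$. 2. Consequently, for every cardinal $\lambda>LS(K)$ with $\mathrm{cf}\,\lambda=\kappa$, $K$ is * fully $(<\lambda,\lambda)$-tame: for every index set $I$, every $M\in K$ with $\|M\|=\lambda$ and all $p\neq q$ in $S^I(M)$, there is $N\prec M$ with $\|N\|<\lambda$ and $p\restriction N\neq q\restriction N$; and * fully $(<\lambda,\lambda)$-type short: for every $M\in K$, every index set $I$ with $|I|=\lambda$ and all $p\neq q$ in $S^I(M)$, there is $J\subseteq I$ with $|J|<\lambda$ and $p^J\neq q^J$. -/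

import Mathlib

open Cardinal Set
open scoped FirstOrder

universe u

namespace AECType

variable {L : FirstOrder.Language.{u, u}}

/-! ### Measurable cardinals -/

/-- `κ` is measurable: it is uncountable and there is a nonprincipal `κ`-complete ultrafilter
on a set of cardinality `κ`. -/
def IsMeasurableCardinal (κ : Cardinal.{u}) : Prop :=
  ℵ₀ < κ ∧ ∃ (X : Type u) (U : Ultrafilter X), #X = κ ∧
    CardinalInterFilter (U : Filter X) κ ∧ ∀ x : X, {x} ∉ U

/-! ### Abstract elementary classes

Models are `L`-structures on types in `Type u`.  The strong submodel relation `S ≺ N` is a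
predicate on substructures `S` of `L`-structures `N`. -/

/-- For substructures `S`, `T` of the same structure, `S` (intersected with `T`) as a
substructure of `T`.  It is used only when `S ≤ T`. -/
abbrev within {N : Type u} [L.Structure N] (S T : L.Substructure N) : L.Substructure T :=
  S.comap T.subtype.toHom

/-- The data of an abstract class of `L`-structures: which structures are models,
and which substructures `S` of `N` satisfy `S ≺ N`. -/
structure AbstractClass (L : FirstOrder.Language.{u, u}) where
  /-- `M ∈ K` -/
  Mod : (M : Type u) → [L.Structure M] → Prop
  /-- `S ≺ N` -/
  Strong : {N : Type u} → [L.Structure N] → L.Substructure N → Prop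

namespace AbstractClass

/-- `S ≺ T` for two substructures of a common structure. -/
def Le (K : AbstractClass L) {N : Type u} [L.Structure N] (S T : L.Substructure N) : Prop :=
  S ≤ T ∧ K.Strong (within S T)

/-- A nonempty, `≺`-increasing, continuous chain of members of `K`, indexed by a well-order and
situated in some `L`-structure `N` (for instance in its own union). -/
structure IsContinuousChain (K : AbstractClass L) {N : Type u} [L.Structure N]
    {ι : Type u} [LinearOrder ι] (S : ι → L.Substructure N) : Prop where
  nonempty : Nonempty ι
  wellFounded : WellFoundedLT ι
  mod : ∀ i, K.Mod (S i)
  le : ∀ i j, i ≤ j → K.Le (S i) (S j)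
  continuous : ∀ j, Order.IsSuccLimit j → S j = ⨆ i : Iio j, S i

/-- The Löwenheim–Skolem property for the cardinal `lam`. -/
def IsLSBound (K : AbstractClass L) (lam : Cardinal.{u}) : Prop :=
  L.card + ℵ₀ ≤ lam ∧
    ∀ (N : Type u) [L.Structure N], K.Mod N → ∀ A : Set N,
      ∃ S : L.Substructure N, K.Strong S ∧ A ⊆ S ∧ #S ≤ #A + lam

end AbstractClass

/-- An abstract elementary class in the language `L`. -/
structure AEC (L : FirstOrder.Language.{u, u}) extends AbstractClass L where
  /-- As usual, structures are nonempty. -/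
  nonempty : ∀ (M : Type u) [L.Structure M], Mod M → Nonempty M
  /-- `≺` is a relation between members of `K`. -/
  strong_mod : ∀ (N : Type u) [L.Structure N] (S : L.Substructure N),
    Strong S → Mod S ∧ Mod N
  strong_refl : ∀ (N : Type u) [L.Structure N], Mod N → Strong (⊤ : L.Substructure N)
  strong_trans : ∀ (N : Type u) [L.Structure N] (S T : L.Substructure N),
    toAbstractClass.Le S T → Strong T → Strong S
  mod_iso : ∀ (N N' : Type u) [L.Structure N] [L.Structure N'], (N ≃[L] N') → Mod N → Mod N'
  strong_iso : ∀ (N N' : Type u) [L.Structure N] [L.Structure N'] (f : N ≃[L] N')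
    (S : L.Substructure N), Strong S → Strong (S.map f.toHom)
  coherence : ∀ (N : Type u) [L.Structure N] (S T : L.Substructure N),
    Strong S → Strong T → S ≤ T → toAbstractClass.Le S T
  /-- The union of a chain is in `K` and is a strong extension of the members of the chain. -/
  union_mod : ∀ (N : Type u) [L.Structure N] (ι : Type u) [LinearOrder ι]
    (S : ι → L.Substructure N), toAbstractClass.IsContinuousChain S →
      Mod (⨆ i, S i : L.Substructure N) ∧ ∀ i, toAbstractClass.Le (S i) (⨆ i, S i)
  /-- If all members of a chain are strong in `N`, then so is the union. -/
  union_strong : ∀ (N : Type u) [L.Structure N] (ι : Type u) [LinearOrder ι]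
    (S : ι → L.Substructure N), toAbstractClass.IsContinuousChain S → Mod N →
      (∀ i, Strong (S i)) → Strong (⨆ i, S i)
  exists_ls : ∃ lam, toAbstractClass.IsLSBound lam

namespace AEC

/-- The Löwenheim–Skolem number `LS(K)`. -/
noncomputable def LS (K : AEC L) : Cardinal.{u} := sInf {lam | K.IsLSBound lam}

/-- An `L`-embedding `f : M → N` is a `K`-embedding if `f(M) ≺ N`. -/
def IsEmb (K : AEC L) {M N : Type u} [L.Structure M] [L.Structure N] (f : M ↪[L] N) : Prop :=
  K.Strong f.toHom.range

theorem isEmb_refl (K : AEC L) {N : Type u} [L.Structure N] (h : K.Mod N) :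
    K.IsEmb (FirstOrder.Language.Embedding.refl L N) := by
  have : (FirstOrder.Language.Embedding.refl L N).toHom.range = ⊤ := by
    ext x; simp
  unfold IsEmb
  rw [this]
  exact K.strong_refl N h

/-- If `S ≺ M` and `f : M → N` is a `K`-embedding, then `f` restricted to `S` is one. -/
theorem IsEmb.comp_subtype (K : AEC L) {M N : Type u} [L.Structure M] [L.Structure N]
    {f : M ↪[L] N} (hf : K.IsEmb f) {S : L.Substructure M} (hS : K.Strong S) :
    K.IsEmb (f.comp S.subtype) := by
  have h := K.strong_iso M f.toHom.range f.equivRange S hS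
  refine K.strong_trans N _ f.toHom.range ⟨?_, ?_⟩ hf
  · intro x hx
    obtain ⟨y, rfl⟩ := FirstOrder.Language.Hom.mem_range.1 hx
    exact FirstOrder.Language.Hom.mem_range.2 ⟨(y : M), rfl⟩
  · convert h using 1
    ext ⟨x, hx⟩
    simp only [within, FirstOrder.Language.Substructure.mem_comap,
      FirstOrder.Language.Substructure.mem_map]
    constructor
    · intro hx'
      obtain ⟨y, hy⟩ := FirstOrder.Language.Hom.mem_range.1 hx'
      exact ⟨(y : M), y.2, Subtype.ext hy⟩
    · rintro ⟨y, hy, hyx⟩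
      exact FirstOrder.Language.Hom.mem_range.2 ⟨⟨y, hy⟩, congrArg Subtype.val hyx⟩

/-! ### Galois types -/

/-- A pretype `(⟨a i : i ∈ I⟩, M, N)` over `M`: the extension `M ≺ N` is given by a `K`-embedding
of `M` into `N`.  No bound is put on the size of `N`; by the Löwenheim–Skolem axiom, `N` can
always be replaced by a strong submodel containing `M` and the `a i`, of size at most
`‖M‖ + |I| + LS(K)`, and this changes neither the types nor their equality. -/
structure Pretype (K : AEC L) (M : Type u) [L.Structure M] (I : Type u) : Type (u + 1) where
  N : Type u
  [str : L.Structure N]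
  emb : M ↪[L] N
  isEmb : K.IsEmb emb
  a : I → N

attribute [instance] Pretype.str

/-- Atomic equivalence of pretypes over `M`: the two extensions can be amalgamated over `M` in
a way that identifies the two sequences. -/
def Pretype.AT {K : AEC L} {M : Type u} [L.Structure M] {I : Type u} (p q : K.Pretype M I) :
    Prop :=
  ∃ (N' : Type u) (_ : L.Structure N') (f : p.N ↪[L] N') (g : q.N ↪[L] N'),
    K.IsEmb f ∧ K.IsEmb g ∧ (∀ m, f (p.emb m) = g (q.emb m)) ∧ ∀ i, f (p.a i) = g (q.a i)

theorem Pretype.AT.refl {K : AEC L} {M : Type u} [L.Structure M] {I : Type u}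
    (p : K.Pretype M I) : p.AT p :=
  have h := K.isEmb_refl (K.strong_mod _ _ p.isEmb).2
  ⟨p.N, p.str, .refl L p.N, .refl L p.N, h, h, fun _ => rfl, fun _ => rfl⟩

theorem Pretype.AT.symm {K : AEC L} {M : Type u} [L.Structure M] {I : Type u}
    {p q : K.Pretype M I} : p.AT q → q.AT p := by
  rintro ⟨N', s, f, g, hf, hg, hm, ha⟩
  exact ⟨N', s, g, f, hg, hf, fun m => (hm m).symm, fun i => (ha i).symm⟩

/-- `∼`, the transitive closure of atomic equivalence. -/
instance Pretype.setoid (K : AEC L) (M : Type u) [L.Structure M] (I : Type u) :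
    Setoid (K.Pretype M I) where
  r := Relation.TransGen Pretype.AT
  iseqv :=
    { refl := fun p => .single (.refl p)
      symm := fun h => by
        induction h with
        | single h => exact .single h.symm
        | tail _ h ih => exact .head h.symm ih
      trans := fun h₁ h₂ => h₁.trans h₂ }

/-- `S^I(M)`: the Galois types over `M` of sequences indexed by `I`. -/
def GaloisType (K : AEC L) (M : Type u) [L.Structure M] (I : Type u) : Type (u + 1) :=
  Quotient (Pretype.setoid K M I)

/-- `(⟨a i : i ∈ I⟩, M, N) ↦ (⟨a i : i ∈ J⟩, M, N)` for `J ⊆ I`. -/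
def Pretype.restrictIndex {K : AEC L} {M : Type u} [L.Structure M] {I : Type u}
    (p : K.Pretype M I) (J : Set I) : K.Pretype M J where
  N := p.N
  emb := p.emb
  isEmb := p.isEmb
  a := fun i => p.a i

/-- `(⟨a i : i ∈ I⟩, M, N) ↦ (⟨a i : i ∈ I⟩, S, N)` for `S ≺ M`. -/
def Pretype.restrict {K : AEC L} {M : Type u} [L.Structure M] {I : Type u}
    (p : K.Pretype M I) {S : L.Substructure M} (hS : K.Strong S) : K.Pretype S I where
  N := p.N
  emb := p.emb.comp S.subtype
  isEmb := p.isEmb.comp_subtype K hS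
  a := p.a

theorem Pretype.AT.restrictIndex {K : AEC L} {M : Type u} [L.Structure M] {I : Type u}
    {p q : K.Pretype M I} (h : p.AT q) (J : Set I) :
    (p.restrictIndex J).AT (q.restrictIndex J) := by
  obtain ⟨N', s, f, g, hf, hg, hm, ha⟩ := h
  exact ⟨N', s, f, g, hf, hg, hm, fun i => ha i⟩

theorem Pretype.AT.restrict {K : AEC L} {M : Type u} [L.Structure M] {I : Type u}
    {p q : K.Pretype M I} (h : p.AT q) {S : L.Substructure M} (hS : K.Strong S) :
    (p.restrict hS).AT (q.restrict hS) := by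
  obtain ⟨N', s, f, g, hf, hg, hm, ha⟩ := h
  exact ⟨N', s, f, g, hf, hg, fun m => hm m, ha⟩

/-- `p^J` for `J ⊆ I` -/
def GaloisType.restrictIndex {K : AEC L} {M : Type u} [L.Structure M] {I : Type u}
    (p : K.GaloisType M I) (J : Set I) : K.GaloisType M J :=
  Quotient.map (fun p : K.Pretype M I => p.restrictIndex J)
    (fun _ _ h => Relation.TransGen.lift _ (fun _ _ h => Pretype.AT.restrictIndex h J) _ _ h) p

/-- `p ↾ S` for `S ≺ M` -/
def GaloisType.restrict {K : AEC L} {M : Type u} [L.Structure M] {I : Type u}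
    (p : K.GaloisType M I) {S : L.Substructure M} (hS : K.Strong S) : K.GaloisType S I :=
  Quotient.map (fun p : K.Pretype M I => p.restrict hS)
    (fun _ _ h => Relation.TransGen.lift _ (fun _ _ h => Pretype.AT.restrict h hS) _ _ h) p

/-- Full `(<κ, lam)`-tameness: for every index set `I`, distinct types in `S^I(M)` with
`‖M‖ = lam` already differ over some `S ≺ M` with `‖S‖ < κ`. -/
def FullyTame (K : AEC L) (κ lam : Cardinal.{u}) : Prop :=
  ∀ (I M : Type u) [L.Structure M], K.Mod M → #M = lam →
    ∀ p q : K.GaloisType M I, p ≠ q →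
      ∃ (S : L.Substructure M) (hS : K.Strong S), #S < κ ∧ p.restrict hS ≠ q.restrict hS

/-- Full `(<κ, lam)`-type shortness: over models `M` of any size, distinct types of sequences
of length `lam` already differ on some set of fewer than `κ` indices. -/
def FullyTypeShort (K : AEC L) (κ lam : Cardinal.{u}) : Prop :=
  ∀ (I M : Type u) [L.Structure M], K.Mod M → #I = lam →
    ∀ p q : K.GaloisType M I, p ≠ q →
      ∃ J : Set I, #J < κ ∧ p.restrictIndex J ≠ q.restrictIndex J

/-! ### Monster models -/

/-- `C` is a monster model for the members of `K` of size less than `μ`: it has size and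
cofinality at least `μ`, every such `N` embeds into `C`, and if `S ≺ C` and `S ≺ N` (through
`g`), then `N` embeds into `C` over `S`. -/
structure IsMonster (K : AEC L) (μ : Cardinal.{u}) (C : Type u) [L.Structure C] : Prop where
  mod : K.Mod C
  le_card : μ ≤ #C
  le_cof : μ ≤ (#C).ord.cof
  universal : ∀ (N : Type u) [L.Structure N], K.Mod N → #N < μ →
    ∃ f : N ↪[L] C, K.IsEmb f
  homogeneous : ∀ (S : L.Substructure C), K.Strong S →
    ∀ (N : Type u) [L.Structure N] (g : S ↪[L] N), K.IsEmb g → #N < μ →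
      ∃ f : N ↪[L] C, K.IsEmb f ∧ ∀ x : S, f (g x) = x

/-- `K` has a monster model, for whatever set of models is to be considered. -/
def HasMonsterModel (K : AEC L) : Prop :=
  ∀ μ : Cardinal.{u}, ∃ (C : Type u) (_ : L.Structure C), K.IsMonster μ C

end AEC

/-! ### The logic `L_{κ,ω}` -/

/-- Formulas of `L_{κ,ω}` with free variables among `x₀, …, x_{n-1}`.  In `ex φ` the variable
`x_n` of `φ` is bound. -/
inductive InfFormula (L : FirstOrder.Language.{u, u}) (κ : Cardinal.{u}) : ℕ → Type (u + 1)
  | equal {n : ℕ} (t₁ t₂ : L.Term (Fin n)) : InfFormula L κ n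
  | rel {n l : ℕ} (R : L.Relations l) (ts : Fin l → L.Term (Fin n)) : InfFormula L κ n
  | neg {n : ℕ} (φ : InfFormula L κ n) : InfFormula L κ n
  | conj {n : ℕ} (ι : Type u) (hι : #ι < κ) (φ : ι → InfFormula L κ n) : InfFormula L κ n
  | ex {n : ℕ} (φ : InfFormula L κ (n + 1)) : InfFormula L κ n

namespace InfFormula

variable {κ : Cardinal.{u}}

/-- Satisfaction. -/
def Realize (M : Type u) [L.Structure M] : {n : ℕ} → InfFormula L κ n → (Fin n → M) → Prop
  | _, equal t₁ t₂, v => t₁.realize v = t₂.realize v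
  | _, rel R ts, v => FirstOrder.Language.Structure.RelMap R fun i => (ts i).realize v
  | _, neg φ, v => ¬ φ.Realize M v
  | _, conj _ _ φ, v => ∀ i, (φ i).Realize M v
  | _, ex φ, v => ∃ x : M, φ.Realize M (Fin.snoc v x)

/-- Substitution of terms for the free variables. -/
def subst : {n : ℕ} → InfFormula L κ n → {m : ℕ} → (Fin n → L.Term (Fin m)) → InfFormula L κ m
  | _, equal t₁ t₂, _, s => equal (t₁.subst s) (t₂.subst s)
  | _, rel R ts, _, s => rel R fun i => (ts i).subst s
  | _, neg φ, _, s => neg (φ.subst s)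
  | _, conj ι hι φ, _, s => conj ι hι fun i => (φ i).subst s
  | _, ex φ, m, s => ex (φ.subst
      (Fin.snoc (fun i => (s i).relabel Fin.castSucc) (FirstOrder.Language.Term.var (Fin.last m))))

/-- A fragment of `L_{κ,ω}`: a set of formulas containing the atomic formulas and closed under
negation, finite conjunction, quantification, subformulas and substitution. -/
structure IsFragment (F : (n : ℕ) → Set (InfFormula L κ n)) : Prop where
  equal_mem : ∀ {n : ℕ} (t₁ t₂ : L.Term (Fin n)), equal t₁ t₂ ∈ F n
  rel_mem : ∀ {n l : ℕ} (R : L.Relations l) (ts : Fin l → L.Term (Fin n)), rel R ts ∈ F n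
  neg_mem : ∀ {n : ℕ} {φ : InfFormula L κ n}, φ.neg ∈ F n ↔ φ ∈ F n
  conj_mem : ∀ {n : ℕ} (ι : Type u) (hι : #ι < κ) (φ : ι → InfFormula L κ n), Finite ι →
    (∀ i, φ i ∈ F n) → conj ι hι φ ∈ F n
  of_conj_mem : ∀ {n : ℕ} (ι : Type u) (hι : #ι < κ) (φ : ι → InfFormula L κ n),
    conj ι hι φ ∈ F n → ∀ i, φ i ∈ F n
  ex_mem : ∀ {n : ℕ} {φ : InfFormula L κ (n + 1)}, φ.ex ∈ F n ↔ φ ∈ F (n + 1)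
  subst_mem : ∀ {n m : ℕ} (φ : InfFormula L κ n) (s : Fin n → L.Term (Fin m)),
    φ ∈ F n → φ.subst s ∈ F m

/-- `S ≺_F N`: the formulas in `F` have the same truth values in `S` and in `N`. -/
def ElemSub (F : (n : ℕ) → Set (InfFormula L κ n)) {N : Type u} [L.Structure N]
    (S : L.Substructure N) : Prop :=
  ∀ (n : ℕ), ∀ φ ∈ F n, ∀ v : Fin n → S,
    φ.Realize S v ↔ φ.Realize N fun i => (v i : N)

end InfFormula

/-- `K` is essentially below `κ`: either `LS(K) < κ`, or `K = (Mod T, ≺_F)` for an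
`L_{κ,ω}`-theory `T` and a fragment `F` of `L_{κ,ω}`. -/
def AEC.EssentiallyBelow (K : AEC L) (κ : Cardinal.{u}) : Prop :=
  K.LS < κ ∨
    ∃ (T : Set (InfFormula L κ 0)) (F : (n : ℕ) → Set (InfFormula L κ n)),
      InfFormula.IsFragment F ∧
      (∀ (M : Type u) [L.Structure M],
        K.Mod M ↔ Nonempty M ∧ ∀ φ ∈ T, φ.Realize M Fin.elim0) ∧
      ∀ (N : Type u) [L.Structure N] (S : L.Substructure N),
        K.Strong S ↔ K.Mod S ∧ K.Mod N ∧ InfFormula.ElemSub F S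

end AECType

namespace AECType

open FirstOrder Language

variable {L : FirstOrder.Language.{u, u}}

namespace AEC

variable (K : AEC L)

/-! ### Transport along isomorphisms -/

/-! The core is a closure property, `AEC.EssentiallyBelow.isEmb_ultraEmb`: if all `f i : M → N i`
are `K`-embeddings, so is the diagonal map of `M` into the ultraproduct of the `N i` by a
`κ`-complete ultrafilter. Suppose `p` and `q` agree at every stage `α < κ`. The monster model gives
amalgamation, hence `∼` is `AT`, and some `N α` receives both extensions in a way compatible on `M
α` and `I α`. A nonprincipal `κ`-complete ultrafilter on `κ` contains all final segments, so in the
ultraproduct of the `N α` the two diagonal maps agree on all of `M` and at every index; thus `p =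
q`. For tameness, `M` is resolved into `κ = cf λ` pieces smaller than `λ` while the index set stays
constant; for type shortness the roles are exchanged.

For `(Mod T, ≺_F)` the closure property is Łoś's theorem for `L_{κ,ω}`. If `LS(K) < κ`, counting
replaces syntax: a pair `S i ≺ T i` of size at most `LS(K)` has fewer than `κ` atomic facts, so by
`κ`-completeness the ultraproduct of such pairs is isomorphic to almost every one of them
(`AEC.le_ultraSub_of_small`). Larger models are directed unions of small strong submodels, and
closure of an AEC under directed unions (`AEC.sSup_directed`) gives the general case. -/

theorem strong_of_equiv {A B : Type u} [L.Structure A] [L.Structure B] (e : A ≃[L] B)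
    {S : L.Substructure A} {S' : L.Substructure B} (h : ∀ x, x ∈ S ↔ e x ∈ S')
    (hS : K.Strong S) : K.Strong S' := by
  have : S' = S.map e.toHom := by
    ext y
    rw [Substructure.mem_map]
    constructor
    · intro hy
      exact ⟨e.symm y, (h _).2 (by simpa using hy), by simp⟩
    · rintro ⟨x, hx, rfl⟩
      exact (h x).1 hx
  exact this ▸ K.strong_iso A B e S hS

theorem le_map_iff {A B : Type u} [L.Structure A] [L.Structure B] (f : A ↪[L] B)
    {S T : L.Substructure A} :
    K.Le (S.map f.toHom) (T.map f.toHom) ↔ K.Le S T := by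
  have hST : S.map f.toHom ≤ T.map f.toHom ↔ S ≤ T :=
    Substructure.map_le_map_iff_of_injective (f := f.toHom) f.injective
  have key : ∀ x : T, x ∈ within S T ↔
      f.substructureEquivMap T x ∈ within (S.map f.toHom) (T.map f.toHom) := by
    intro x
    simp only [within, Substructure.mem_comap, Substructure.mem_map]
    constructor
    · intro hx
      exact ⟨x, hx, rfl⟩
    · rintro ⟨y, hy, hyx⟩
      have : y = x := f.injective hyx
      rw [this] at hy
      exact hy
  refine and_congr hST ⟨fun h => ?_, fun h => K.strong_of_equiv _ key h⟩
  refine K.strong_of_equiv (f.substructureEquivMap T).symm (fun x => ?_) h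
  rw [key]
  simp

/-- This lets `Strong` be treated as a case of the transitive relation `Le`. -/
theorem le_top_iff {N : Type u} [L.Structure N] {S : L.Substructure N} :
    K.Le S ⊤ ↔ K.Strong S := by
  constructor
  · intro h
    exact K.strong_of_equiv Substructure.topEquiv (fun x => Iff.rfl) h.2
  · intro h
    refine ⟨le_top, K.strong_of_equiv Substructure.topEquiv.symm (fun x => ?_) h⟩
    rfl

theorem le_within_iff {N : Type u} [L.Structure N] {S T V : L.Substructure N}
    (hS : S ≤ V) (hT : T ≤ V) : K.Le (within S V) (within T V) ↔ K.Le S T := by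
  have h : ∀ {S : L.Substructure N}, S ≤ V → (within S V).map V.subtype.toHom = S := by
    intro S hS
    ext x
    simp only [within, Substructure.mem_map, Substructure.mem_comap]
    constructor
    · rintro ⟨y, hy, rfl⟩
      exact hy
    · intro hx
      exact ⟨⟨x, hS hx⟩, hx, rfl⟩
  rw [← K.le_map_iff V.subtype, h hS, h hT]

theorem mod_iff_of_equiv {A B : Type u} [L.Structure A] [L.Structure B] (e : A ≃[L] B) :
    K.Mod A ↔ K.Mod B :=
  ⟨K.mod_iso A B e, K.mod_iso B A e.symm⟩

/-- For `S ≤ V`, the substructure `within S V` is isomorphic to `S`. -/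
def withinEquiv {N : Type u} [L.Structure N] {S V : L.Substructure N}
    (h : S ≤ V) : within S V ≃[L] S where
  toFun x := ⟨x.1.1, x.2⟩
  invFun x := ⟨⟨x.1, h x.2⟩, x.2⟩
  left_inv _ := rfl
  right_inv _ := rfl
  map_fun' _ _ := rfl
  map_rel' _ _ := Iff.rfl

end AEC

/-! ### Reflexivity and transitivity of `≺` between substructures -/

namespace AbstractClass.Le

variable {K : AEC L}

theorem mod_left {N : Type u} [L.Structure N] {S T : L.Substructure N} (h : K.Le S T) :
    K.Mod S :=
  (K.mod_iff_of_equiv (AEC.withinEquiv h.1)).1 (K.strong_mod _ _ h.2).1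

theorem mod_right {N : Type u} [L.Structure N] {S T : L.Substructure N} (h : K.Le S T) :
    K.Mod T :=
  (K.strong_mod _ _ h.2).2

theorem refl {N : Type u} [L.Structure N] {S : L.Substructure N} (h : K.Mod S) :
    K.Le S S := by
  refine ⟨le_rfl, ?_⟩
  have : within S S = ⊤ := by
    ext x
    simp [within]
  rw [this]
  exact K.strong_refl _ h

theorem trans {N : Type u} [L.Structure N] {S T V : L.Substructure N}
    (h₁ : K.Le S T) (h₂ : K.Le T V) : K.Le S V :=
  ⟨h₁.1.trans h₂.1, K.strong_trans _ _ _
    ((K.le_within_iff (h₁.1.trans h₂.1) h₂.1).2 h₁) h₂.2⟩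

end AbstractClass.Le

namespace AEC

variable {K : AEC L}

/-! ### Unions of chains and of directed systems -/

/-- The axiom `union_strong` speaks of a whole structure, so the chain is pulled back to `T`, where
it is still a continuous chain. -/
theorem iSup_chain_le {N : Type u} [L.Structure N] {ι : Type u} [LinearOrder ι]
    {S : ι → L.Substructure N} (hS : K.IsContinuousChain S) {T : L.Substructure N}
    (hT : K.Mod T) (h : ∀ i, K.Le (S i) T) : K.Le (⨆ i, S i) T := by
  have hne := hS.nonempty
  have hmono : ∀ {i j}, i ≤ j → S i ≤ S j := fun hij => (hS.le _ _ hij).1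
  have hchain : K.IsContinuousChain fun i => within (S i) T :=
    { nonempty := hne
      wellFounded := hS.wellFounded
      mod := fun i => (K.mod_iff_of_equiv (withinEquiv (h i).1)).2 (hS.mod i)
      le := fun i j hij => (K.le_within_iff (h i).1 (h j).1).2 (hS.le i j hij)
      continuous := by
        intro j hj
        obtain ⟨i₀, hi₀⟩ := not_isMin_iff.1 hj.1
        have : Nonempty (Iio j) := ⟨⟨i₀, hi₀⟩⟩
        have d₁ : Directed (· ≤ ·) fun i : Iio j => S i :=
          directed_of_isDirected_le fun a b hab => hmono hab
        have d₂ : Directed (· ≤ ·) fun i : Iio j => within (S i) T :=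
          directed_of_isDirected_le fun a b hab x hx => hmono hab hx
        ext x
        rw [Substructure.mem_iSup_of_directed d₂]
        change (x : N) ∈ S j ↔ _
        rw [hS.continuous j hj, Substructure.mem_iSup_of_directed d₁]
        rfl }
  have key := K.union_strong T ι _ hchain hT fun i => (h i).2
  refine ⟨iSup_le fun i => (h i).1, ?_⟩
  convert key using 1
  have d₁ : Directed (· ≤ ·) S := directed_of_isDirected_le fun a b hab => hmono hab
  have d₂ : Directed (· ≤ ·) fun i => within (S i) T :=
    directed_of_isDirected_le fun a b hab x hx => hmono hab hx
  ext x
  rw [Substructure.mem_iSup_of_directed d₂]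
  change (x : N) ∈ iSup S ↔ _
  rw [Substructure.mem_iSup_of_directed d₁]
  rfl

/-- In a directed system one can choose upper bounds of finite sets coherently. -/
theorem exists_finset_bound {α : Type u} {r : α → α → Prop} [IsTrans α r] [Nonempty α]
    (h : Directed r (id : α → α)) :
    ∃ F : Finset α → α, ∀ s, (∀ d ∈ s, r d (F s)) ∧ ∀ t, t ⊂ s → r (F t) (F s) := by
  classical
  choose pick hpick using fun s : Finset α => h.finset_le s
  -- `F s` bounds the elements of `s` together with the finitely many values `F t` for `t ⊂ s`.
  refine ⟨Finset.strongInduction fun s F =>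
    pick (s ∪ s.ssubsets.attach.image fun t => F t.1 (Finset.mem_ssubsets.1 t.2)), fun s => ?_⟩
  rw [Finset.strongInduction_eq]
  refine ⟨fun d hd => hpick _ d (Finset.mem_union_left _ hd), fun t ht => ?_⟩
  refine hpick _ _ (Finset.mem_union_right _ (Finset.mem_image.2
    ⟨⟨t, Finset.mem_ssubsets.2 ht⟩, Finset.mem_attach _ _, rfl⟩))

/-- An abstract elementary class is closed under unions of directed systems. -/
theorem sSup_directed {N : Type u} [L.Structure N] (D : Set (L.Substructure N))
    (hne : D.Nonempty) (hD : DirectedOn K.Le D) :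
    (∀ S ∈ D, K.Le S (sSup D)) ∧
      ∀ T : L.Substructure N, K.Mod T → (∀ S ∈ D, K.Le S T) → K.Le (sSup D) T := by
  -- By induction on `#D`, the system is cut into a continuous chain of unions of smaller directed
  -- systems; a countable system contains a cofinal `ω`-chain.
  induction hc : #D using WellFoundedLT.induction generalizing D with
  | ind lam ih =>
  subst hc
  have : Nonempty D := hne.to_subtype
  let r : D → D → Prop := fun S T => K.Le (S : L.Substructure N) T
  have : IsTrans D r := ⟨fun _ _ _ => AbstractClass.Le.trans⟩
  have hdir : Directed r (id : D → D) := fun S T => by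
    obtain ⟨V, hV, h₁, h₂⟩ := hD S S.2 T T.2
    exact ⟨⟨V, hV⟩, h₁, h₂⟩
  have hmod : ∀ S : D, K.Mod (S : L.Substructure N) := fun S => by
    obtain ⟨V, hV, h₁, h₂⟩ := hD S S.2 S S.2
    exact h₁.mod_left
  obtain ⟨F, hF⟩ := exists_finset_bound hdir
  have hFle : ∀ s t : Finset D, s ⊆ t → K.Le (F s : L.Substructure N) (F t) := by
    intro s t hst
    rcases hst.eq_or_ssubset with rfl | h
    · exact .refl (hmod _)
    · exact (hF t).2 s h
  rcases le_or_gt #D ℵ₀ with hcount | hunc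
  · have : Countable D := mk_le_aleph0_iff.1 hcount
    obtain ⟨d, hd⟩ := exists_surjective_nat D
    classical
    let e : ULift.{u} ℕ → L.Substructure N := fun n => F ((Finset.range (n.down + 1)).image d)
    have hchain : K.IsContinuousChain e :=
      { nonempty := inferInstance
        wellFounded := ⟨InvImage.wf ULift.down wellFounded_lt⟩
        mod := fun _ => hmod _
        le := fun i j hij => hFle _ _ (Finset.image_mono _ (Finset.range_mono
          (Nat.succ_le_succ hij)))
        continuous := by
          intro j hj
          -- There are no limits in `ω`: a nonzero `j` covers `j - 1`.
          exfalso
          obtain ⟨i₀, hi₀⟩ := not_isMin_iff.1 hj.1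
          have hi₀' : i₀.down < j.down := hi₀
          refine hj.2 ⟨j.down - 1⟩ ⟨?_, ?_⟩
          · change j.down - 1 < j.down
            omega
          · intro c h₁ h₂
            have h₁' : j.down - 1 < c.down := h₁
            have h₂' : c.down < j.down := h₂
            omega }
    have hle := (K.union_mod N _ e hchain).2
    have hde : ∀ n, K.Le (d n : L.Substructure N) (e ⟨n⟩) := fun n =>
      (hF _).1 _ (Finset.mem_image.2 ⟨n, by simp, rfl⟩)
    have hsup : sSup D = ⨆ n, e n := by
      refine le_antisymm (sSup_le fun S hS => ?_) (iSup_le fun n => le_sSup (F _).2)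
      obtain ⟨n, hn⟩ := hd ⟨S, hS⟩
      have := (hde n).1
      rw [hn] at this
      exact this.trans (le_iSup e _)
    rw [hsup]
    refine ⟨fun S hS => ?_, fun T hT h => iSup_chain_le hchain hT fun n => h _ (F _).2⟩
    obtain ⟨n, hn⟩ := hd ⟨S, hS⟩
    have := hde n
    rw [hn] at this
    exact this.trans (hle _)
  · let ι := (#D).ord.ToType
    have hι : #ι = #D := by simp [ι, mk_toType]
    obtain ⟨ρ⟩ : Nonempty (D ≃ ι) := Cardinal.eq.1 hι.symm
    have hnomax : ∀ i : ι, ∃ j, i < j := by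
      intro i
      have := Cardinal.noMaxOrder (c := #D) hunc.le
      exact exists_gt i
    have : Nonempty ι := ⟨ρ (Classical.arbitrary D)⟩
    -- `E i` consists of the chosen bounds of finite sets of members enumerated before `i`. It is
    -- directed because `F` is monotone, even though the members enumerated before `i` need not be.
    let fin : ι → Set (Finset D) := fun i => {s | ∀ d ∈ s, ρ d < i}
    let E : ι → Set (L.Substructure N) := fun i => (fun s => (F s : L.Substructure N)) '' fin i
    have hED : ∀ i, E i ⊆ D := by
      rintro i _ ⟨s, -, rfl⟩
      exact (F s).2
    have hEmono : ∀ {i j}, i ≤ j → E i ⊆ E j := by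
      rintro i j hij _ ⟨s, hs, rfl⟩
      exact ⟨s, fun d hd => (hs d hd).trans_le hij, rfl⟩
    have hEne : ∀ i, (E i).Nonempty := fun i => ⟨_, ∅, by simp [fin], rfl⟩
    have hEdir : ∀ i, DirectedOn K.Le (E i) := by
      classical
      rintro i _ ⟨s, hs, rfl⟩ _ ⟨t, ht, rfl⟩
      refine ⟨_, ⟨s ∪ t, ?_, rfl⟩, hFle _ _ Finset.subset_union_left,
        hFle _ _ Finset.subset_union_right⟩
      intro d hd
      rcases Finset.mem_union.1 hd with h | h
      exacts [hs d h, ht d h]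
    have hEcard : ∀ i, #(E i) < #D := by
      intro i
      have h₁ : #(Iio i) < #D := by
        exact (mk_Iio_lt i (by rw [hι, Ordinal.type_toType])).trans_eq hι
      -- Finite sets are counted by lists, of which there are at most `max ℵ₀ #(Iio i)`; this is
      -- below `#D` because `D` is uncountable.
      have h₂ : #(E i) ≤ #(List (Iio i)) := by
        refine mk_le_of_surjective (f := fun l : List (Iio i) => ?_) ?_
        · classical
          exact ⟨F (l.map fun x => ρ.symm x.1).toFinset, _, by
            intro d hd
            obtain ⟨x, -, rfl⟩ := List.mem_map.1 (List.mem_toFinset.1 hd)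
            rw [Equiv.apply_symm_apply]
            exact x.2, rfl⟩
        · rintro ⟨_, s, hs, rfl⟩
          refine ⟨s.attach.toList.map fun d => ⟨ρ d.1, hs d.1 d.2⟩, Subtype.ext ?_⟩
          simp only
          congr 2
          ext d
          simp
      exact h₂.trans_lt ((mk_list_le_max _).trans_lt (max_lt hunc h₁))
    have IH := fun i => ih _ (hEcard i) (E i) (hEne i) (hEdir i) rfl
    have hEmod : ∀ i, K.Mod (sSup (E i) : L.Substructure N) := fun i =>
      ((IH i).1 _ (hEne i).some_mem).mod_right
    have hchain : K.IsContinuousChain fun i => sSup (E i) :=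
      { nonempty := inferInstance
        wellFounded := inferInstance
        mod := hEmod
        le := fun i j hij => (IH i).2 _ (hEmod j) fun S hS => (IH j).1 S (hEmono hij hS)
        continuous := by
          intro j hj
          refine le_antisymm (sSup_le ?_) (iSup_le fun i => sSup_le_sSup (hEmono i.2.le))
          rintro _ ⟨s, hs, rfl⟩
          -- A finite set of indices below the limit `j` is bounded below `j`, whence continuity.
          have : ∃ i < j, ∀ d ∈ s, ρ d < i := by
            classical
            clear ih IH
            induction s using Finset.induction_on with
            | empty =>
              obtain ⟨i₀, hi₀⟩ := not_isMin_iff.1 hj.1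
              exact ⟨i₀, hi₀, by simp⟩
            | insert a s _ ihs =>
              obtain ⟨i, hi, h⟩ := ihs fun d hd => hs d (Finset.mem_insert_of_mem hd)
              obtain ⟨k, hk, hkj⟩ := (not_covBy_iff (hs a (Finset.mem_insert_self _ _))).1 (hj.2 _)
              refine ⟨max i k, max_lt hi hkj, fun d hd => ?_⟩
              rcases Finset.mem_insert.1 hd with rfl | hd
              · exact lt_max_of_lt_right hk
              · exact lt_max_of_lt_left (h d hd)
          obtain ⟨i, hi, h⟩ := this
          exact (le_sSup (show (F s : L.Substructure N) ∈ E i from ⟨s, h, rfl⟩)).trans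
            (le_iSup (fun i : Iio j => sSup (E i)) ⟨i, hi⟩) }
    have hle := (K.union_mod N _ _ hchain).2
    have hdE : ∀ d : D, ∃ i, K.Le (d : L.Substructure N) (sSup (E i)) := by
      intro d
      obtain ⟨j, hj⟩ := hnomax (ρ d)
      have h₁ : K.Le (d : L.Substructure N) (F {d}) := (hF {d}).1 d (Finset.mem_singleton_self d)
      exact ⟨j, h₁.trans ((IH j).1 _ ⟨{d}, fun x hx => by rwa [Finset.mem_singleton.1 hx], rfl⟩)⟩
    have hsup : sSup D = ⨆ i, sSup (E i) := by
      refine le_antisymm (sSup_le fun S hS => ?_) (iSup_le fun i => sSup_le_sSup (hED i))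
      obtain ⟨i, hi⟩ := hdE ⟨S, hS⟩
      exact hi.1.trans (le_iSup (fun i => sSup (E i)) i)
    rw [hsup]
    refine ⟨fun S hS => ?_, fun T hT h => iSup_chain_le hchain hT fun i =>
      (IH i).2 T hT fun S hS => h S (hED i hS)⟩
    obtain ⟨i, hi⟩ := hdE ⟨S, hS⟩
    exact hi.trans (hle i)

end AEC

/-! ### Ultraproducts -/

section Ultraproduct

variable {X : Type u} (U : Ultrafilter X) {N : X → Type u}

/-- The element of the ultraproduct represented by `f`. -/
abbrev ultraMk (f : ∀ i, N i) : (U : Filter X).Product N := (f : (U : Filter X).Product N)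

variable {U}

theorem ultraMk_eq {f g : ∀ i, N i} : ultraMk U f = ultraMk U g ↔ ∀ᶠ i in U, f i = g i :=
  Quotient.eq''

theorem exists_ultraMk (x : (U : Filter X).Product N) : ∃ f, ultraMk U f = x :=
  Quotient.exists_rep x

/-- Almost every factor decides `P` as the ultraproduct does. With `κ`-completeness, fewer than `κ`
such statements can be reflected in one factor simultaneously. -/
theorem eventually_iff_eventually (P : X → Prop) : ∀ᶠ i in U, (P i ↔ ∀ᶠ j in U, P j) := by
  by_cases h : ∀ᶠ j in U, P j
  · filter_upwards [h] with i hi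
    exact ⟨fun _ => h, fun _ => hi⟩
  · filter_upwards [Ultrafilter.eventually_not.2 h] with i hi
    exact ⟨fun h' => absurd h' hi, fun h' => absurd h' h⟩

variable {κ : Cardinal.{u}} [CardinalInterFilter (U : Filter X) κ]

/-- A map into a set of size less than `κ` is constant almost everywhere with respect to a
`κ`-complete ultrafilter. -/
theorem exists_eventually_eq {Y : Type u} (hY : #Y < κ) (η : X → Y) :
    ∃ y, ∀ᶠ i in U, η i = y := by
  by_contra! h
  have h' : ∀ᶠ i in U, ∀ y, η i ≠ y :=
    (Filter.eventually_cardinal_forall hY).2 h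
  obtain ⟨i, hi⟩ := h'.exists
  exact hi _ rfl

variable [∀ i, L.Structure (N i)]

theorem funMap_ultraMk {n : ℕ} (f : L.Functions n) (x : Fin n → ∀ i, N i) :
    Structure.funMap f (fun k => ultraMk U (x k)) =
      ultraMk U fun i => Structure.funMap f fun k => x k i :=
  Ultraproduct.funMap_cast f x

theorem relMap_ultraMk {n : ℕ} (R : L.Relations n) (x : Fin n → ∀ i, N i) :
    Structure.RelMap R (fun k => ultraMk U (x k)) ↔
      ∀ᶠ i in U, Structure.RelMap R fun k => x k i :=
  relMap_quotient_mk' _ R x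

theorem realize_term_ultraMk {Y : Type*} (t : L.Term Y) (x : Y → ∀ i, N i) :
    t.realize (fun k => ultraMk U (x k)) = ultraMk U fun i => t.realize fun k => x k i :=
  Ultraproduct.term_realize_cast x t

variable (U) in
/-- The ultraproduct of substructures, as a substructure of the ultraproduct. -/
def ultraSub (T : ∀ i, L.Substructure (N i)) : L.Substructure ((U : Filter X).Product N) where
  carrier := {x | ∃ f, (∀ᶠ i in U, f i ∈ T i) ∧ ultraMk U f = x}
  fun_mem := by
    intro n F x hx
    choose g hg hgx using hx
    have : x = fun k => ultraMk U (g k) := funext fun k => (hgx k).symm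
    refine ⟨fun i => Structure.funMap F fun k => g k i, ?_, ?_⟩
    · filter_upwards [Filter.eventually_all.2 hg] with i hi
      exact (T i).fun_mem F _ hi
    · rw [this, funMap_ultraMk]

theorem ultraMk_mem_ultraSub {T : ∀ i, L.Substructure (N i)} {f : ∀ i, N i} :
    ultraMk U f ∈ ultraSub U T ↔ ∀ᶠ i in U, f i ∈ T i := by
  constructor
  · rintro ⟨g, hg, hgf⟩
    filter_upwards [hg, ultraMk_eq.1 hgf] with i h₁ h₂
    rwa [← h₂]
  · exact fun h => ⟨f, h, rfl⟩

variable (U) in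
/-- The embedding of `M` into an ultraproduct given by embeddings into the factors. -/
def ultraEmb {M : Type u} [L.Structure M] (f : ∀ i, M ↪[L] N i) :
    M ↪[L] (U : Filter X).Product N where
  toFun m := ultraMk U fun i => f i m
  inj' m m' h := by
    obtain ⟨i, hi⟩ := (ultraMk_eq.1 h).exists
    exact (f i).injective hi
  map_fun' F x := by
    refine Eq.trans ?_ (funMap_ultraMk F fun k i => f i (x k)).symm
    exact congrArg (ultraMk U) (funext fun i => (f i).map_fun F x)
  map_rel' R x := by
    refine (relMap_ultraMk R fun k i => f i (x k)).trans ?_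
    have : ∀ i, Structure.RelMap R (fun k => f i (x k)) ↔ Structure.RelMap R x :=
      fun i => (f i).map_rel R x
    simp only [this, Filter.eventually_const]

/-- Structures enumerated by the same index set with the same atomic diagram are isomorphic. -/
theorem exists_equiv_of_surjective {Y A B : Type u} [L.Structure A] [L.Structure B]
    {a : Y → A} {b : Y → B} (ha : Function.Surjective a) (hb : Function.Surjective b)
    (heq : ∀ y z, a y = a z ↔ b y = b z)
    (hfun : ∀ n (F : L.Functions n) (v : Fin n → Y) y,
      Structure.funMap F (fun k => a (v k)) = a y ↔ Structure.funMap F (fun k => b (v k)) = b y)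
    (hrel : ∀ n (R : L.Relations n) (v : Fin n → Y),
      Structure.RelMap R (fun k => a (v k)) ↔ Structure.RelMap R fun k => b (v k)) :
    ∃ e : A ≃[L] B, ∀ y, e (a y) = b y := by
  obtain ⟨σ, hσ⟩ := ha.hasRightInverse
  have key : ∀ y, b (σ (a y)) = b y := fun y => (heq _ _).1 (hσ _)
  refine ⟨⟨Equiv.ofBijective (fun x => b (σ x)) ⟨fun x y h => ?_, fun y => ?_⟩, ?_, ?_⟩, key⟩
  · rw [← hσ x, ← hσ y]
    exact (heq _ _).2 h
  · obtain ⟨z, rfl⟩ := hb y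
    exact ⟨a z, key z⟩
  · intro n F x
    refine ((hfun n F (fun k => σ (x k)) (σ (Structure.funMap F x))).1 ?_).symm
    simp only [hσ _]
  · intro n R x
    refine (hrel n R fun k => σ (x k)).symm.trans ?_
    simp only [hσ _]

/-! ### Ultraproducts in a class with `LS(K) < κ` -/

variable {K : AEC L}

/-- Ultraproducts of strong pairs of structures of bounded size less than `κ` are strong. -/
theorem AEC.le_ultraSub_of_small {lam : Cardinal.{u}} (hlam : lam < κ) (hω : ℵ₀ ≤ lam)
    (hL : L.card ≤ lam) {S T : ∀ i, L.Substructure (N i)}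
    (hST : ∀ i, K.Le (S i) (T i)) (hT : ∀ i, #(T i) ≤ lam) :
    K.Le (ultraSub U S) (ultraSub U T) := by
  have hY : #lam.out = lam := mk_out lam
  have hYκ : #lam.out < κ := hY.trans_lt hlam
  have : CountableInterFilter (U : Filter X) :=
    CardinalInterFilter.toCountableInterFilter (c := κ) _ (hω.trans_lt hlam)
  have hpow : ∀ n : ℕ, #(Fin n → lam.out) < κ := fun n => by
    simpa [hY] using (power_nat_le hω).trans_lt hlam
  have hFun : ∀ n, #(L.Functions n) < κ := fun n => by
    refine lt_of_le_of_lt ?_ (hL.trans_lt hlam)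
    refine mk_le_of_injective (f := fun F => (Sum.inl ⟨n, F⟩ : L.Symbols)) fun F G h => ?_
    simpa using h
  have hRel : ∀ n, #(L.Relations n) < κ := fun n => by
    refine lt_of_le_of_lt ?_ (hL.trans_lt hlam)
    refine mk_le_of_injective (f := fun F => (Sum.inr ⟨n, F⟩ : L.Symbols)) fun F G h => ?_
    simpa using h
  have hsurj : ∀ i, ∃ e : lam.out → T i, Function.Surjective e := fun i => by
    have : Nonempty (T i) := K.nonempty _ (hST i).mod_right
    obtain ⟨g⟩ : Nonempty (T i ↪ lam.out) := by
      rw [← Cardinal.le_def, hY]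
      exact hT i
    exact ⟨Function.invFun g, Function.invFun_surjective g.injective⟩
  choose e he using hsurj
  let b : lam.out → ultraSub U T := fun y =>
    ⟨ultraMk U fun i => (e i y : N i), ultraMk_mem_ultraSub.2 (.of_forall fun i => (e i y).2)⟩
  -- The position of `f i` in the enumeration of `T i` takes fewer than `κ` values, so it is
  -- constant almost everywhere.
  have hb : Function.Surjective b := by
    rintro ⟨_, f, hf, rfl⟩
    have : ∀ i, ∃ y, f i ∈ T i → (e i y : N i) = f i := fun i => by
      by_cases h : f i ∈ T i
      · obtain ⟨y, hy⟩ := he i ⟨f i, h⟩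
        exact ⟨y, fun _ => by rw [hy]⟩
      · exact ⟨(he i (Classical.choice (K.nonempty _ (hST i).mod_right))).choose,
          fun h' => absurd h' h⟩
    choose η hη using this
    obtain ⟨y, hy⟩ := exists_eventually_eq (U := U) hYκ η
    refine ⟨y, Subtype.ext (ultraMk_eq.2 ?_)⟩
    filter_upwards [hf, hy] with i h₁ h₂
    rw [← h₂, hη i h₁]
  have h₁ : ∀ᶠ i in U, ∀ y z, e i y = e i z ↔ b y = b z := by
    refine (Filter.eventually_cardinal_forall hYκ).2 fun y =>
      (Filter.eventually_cardinal_forall hYκ).2 fun z => ?_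
    have : b y = b z ↔ ∀ᶠ i in U, e i y = e i z := by
      rw [Subtype.ext_iff]
      refine ultraMk_eq.trans ?_
      simp only [Subtype.ext_iff]
    rw [this]
    exact eventually_iff_eventually _
  have h₂ : ∀ᶠ i in U, ∀ n (F : L.Functions n) (v : Fin n → lam.out) y,
      Structure.funMap F (fun k => e i (v k)) = e i y ↔
        Structure.funMap F (fun k => b (v k)) = b y := by
    refine eventually_countable_forall.2 fun n =>
      (Filter.eventually_cardinal_forall (hFun n)).2 fun F =>
      (Filter.eventually_cardinal_forall (hpow n)).2 fun v =>
      (Filter.eventually_cardinal_forall hYκ).2 fun y => ?_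
    have : Structure.funMap F (fun k => b (v k)) = b y ↔
        ∀ᶠ i in U, Structure.funMap F (fun k => e i (v k)) = e i y := by
      rw [Subtype.ext_iff]
      change Structure.funMap F (fun k => ultraMk U fun i => (e i (v k) : N i)) = _ ↔ _
      rw [funMap_ultraMk]
      refine ultraMk_eq.trans ?_
      simp only [Subtype.ext_iff]
      rfl
    rw [this]
    exact eventually_iff_eventually _
  have h₃ : ∀ᶠ i in U, ∀ n (R : L.Relations n) (v : Fin n → lam.out),
      Structure.RelMap R (fun k => e i (v k)) ↔ Structure.RelMap R fun k => b (v k) := by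
    refine eventually_countable_forall.2 fun n =>
      (Filter.eventually_cardinal_forall (hRel n)).2 fun R =>
      (Filter.eventually_cardinal_forall (hpow n)).2 fun v => ?_
    have : Structure.RelMap R (fun k => b (v k)) ↔
        ∀ᶠ i in U, Structure.RelMap R fun k => e i (v k) :=
      relMap_ultraMk R fun k i => (e i (v k) : N i)
    rw [this]
    exact eventually_iff_eventually _
  have h₄ : ∀ᶠ i in U, ∀ y, (e i y : N i) ∈ S i ↔
      (b y : (U : Filter X).Product N) ∈ ultraSub U S := by
    refine (Filter.eventually_cardinal_forall hYκ).2 fun y => ?_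
    rw [ultraMk_mem_ultraSub]
    exact eventually_iff_eventually _
  -- One factor matches the ultraproduct in equality, functions, relations and membership in the
  -- smaller structure, so the isomorphism carries `S i ≺ T i` over.
  obtain ⟨i, h₁, h₂, h₃, h₄⟩ := (h₁.and (h₂.and (h₃.and h₄))).exists
  obtain ⟨φ, hφ⟩ := exists_equiv_of_surjective (he i) hb h₁ h₂ h₃
  refine ⟨?_, K.strong_of_equiv φ (fun x => ?_) (hST i).2⟩
  · rintro _ ⟨f, hf, rfl⟩
    exact ultraMk_mem_ultraSub.2 (hf.mono fun i hi => (hST i).1 hi)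
  · obtain ⟨y, rfl⟩ := he i x
    rw [hφ]
    exact h₄ y

theorem AEC.isLSBound_LS (K : AEC L) : K.IsLSBound K.LS :=
  csInf_mem K.exists_ls

theorem AEC.aleph0_le_LS (K : AEC L) : ℵ₀ ≤ K.LS :=
  le_add_self.trans K.isLSBound_LS.1

theorem AEC.exists_strong_superset {M : Type u} [L.Structure M] (hM : K.Mod M) (A : Set M)
    (hA : #A ≤ K.LS) : ∃ S : L.Substructure M, K.Strong S ∧ A ⊆ S ∧ #S ≤ K.LS := by
  obtain ⟨S, h₁, h₂, h₃⟩ := K.isLSBound_LS.2 M hM A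
  exact ⟨S, h₁, h₂, h₃.trans (add_le_of_le K.aleph0_le_LS hA le_rfl)⟩

theorem AEC.exists_le_le {M : Type u} [L.Structure M] {S T : L.Substructure M}
    (hS : K.Strong S) (hT : K.Strong T) (hS' : #S ≤ K.LS) (hT' : #T ≤ K.LS) :
    ∃ W : L.Substructure M, K.Strong W ∧ #W ≤ K.LS ∧ K.Le S W ∧ K.Le T W := by
  obtain ⟨W, h₁, h₂, h₃⟩ := AEC.exists_strong_superset (K.strong_mod _ _ hS).2 (S ∪ T : Set M)
    ((mk_union_le _ _).trans (add_le_of_le K.aleph0_le_LS hS' hT'))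
  exact ⟨W, h₁, h₃, K.coherence _ _ _ hS h₁ fun x hx => h₂ (.inl hx),
    K.coherence _ _ _ hT h₁ fun x hx => h₂ (.inr hx)⟩

/-- If `LS(K) < κ`, the ultraproduct of small strong submodels is strong in the ultraproduct. -/
theorem AEC.strong_ultraSub (hK : K.LS < κ) (hN : ∀ i, K.Mod (N i))
    {T : ∀ i, L.Substructure (N i)} (hT : ∀ i, K.Strong (T i)) (hT' : ∀ i, #(T i) ≤ K.LS) :
    K.Strong (ultraSub U T) := by
  have hL : L.card ≤ K.LS := le_self_add.trans K.isLSBound_LS.1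
  let D : Set (L.Substructure ((U : Filter X).Product N)) :=
    {V | ∃ T : ∀ i, L.Substructure (N i), (∀ i, K.Strong (T i)) ∧ (∀ i, #(T i) ≤ K.LS) ∧
      ultraSub U T = V}
  have hTD : ultraSub U T ∈ D := ⟨T, hT, hT', rfl⟩
  have hdir : DirectedOn K.Le D := by
    rintro _ ⟨S, hS, hS', rfl⟩ _ ⟨T, hT, hT', rfl⟩
    choose W hW hW' h₁ h₂ using fun i => AEC.exists_le_le (hS i) (hT i) (hS' i) (hT' i)
    exact ⟨_, ⟨W, hW, hW', rfl⟩, le_ultraSub_of_small hK K.aleph0_le_LS hL h₁ hW',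
      le_ultraSub_of_small hK K.aleph0_le_LS hL h₂ hW'⟩
  -- Each `f i` lies in a small strong submodel of `N i`, so every element of the ultraproduct lies
  -- in a member of `D`.
  have htop : sSup D = ⊤ := by
    refine eq_top_iff.2 fun x _ => ?_
    obtain ⟨f, rfl⟩ := exists_ultraMk x
    choose W hW hfW hW' using fun i => AEC.exists_strong_superset (hN i) {f i}
      (by simpa using one_le_aleph0.trans K.aleph0_le_LS)
    have : ultraSub U W ≤ sSup D := le_sSup ⟨W, hW, hW', rfl⟩
    exact this (ultraMk_mem_ultraSub.2 (.of_forall fun i => hfW i rfl))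
  have := (sSup_directed D ⟨_, hTD⟩ hdir).1 _ hTD
  rw [htop] at this
  exact K.le_top_iff.1 this

/-- For small `S ≺ M`, `κ`-completeness makes the diagonal image of `S` equal to the whole
ultraproduct of the images `f i (S)`, which is strong by `AEC.strong_ultraSub`. The image of `M` is
the directed union of these. -/
theorem AEC.isEmb_ultraEmb_of_LS_lt (hK : K.LS < κ) {M : Type u} [L.Structure M]
    (f : ∀ i, M ↪[L] N i) (hf : ∀ i, K.IsEmb (f i)) : K.IsEmb (ultraEmb U f) := by
  have hN : ∀ i, K.Mod (N i) := fun i => (K.strong_mod _ _ (hf i)).2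
  obtain ⟨i₀, -⟩ := (Filter.Eventually.of_forall (f := (U : Filter X)) fun _ => trivial).exists
  have hM : K.Mod M := K.mod_iso _ _ (f i₀).equivRange.symm (K.strong_mod _ _ (hf i₀)).1
  let D : Set (L.Substructure ((U : Filter X).Product N)) :=
    {V | ∃ S : L.Substructure M, K.Strong S ∧ #S ≤ K.LS ∧ S.map (ultraEmb U f).toHom = V}
  have hne : D.Nonempty := by
    obtain ⟨S, h₁, -, h₂⟩ := AEC.exists_strong_superset hM ∅ (by simp)
    exact ⟨_, S, h₁, h₂, rfl⟩
  have hdir : DirectedOn K.Le D := by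
    rintro _ ⟨S, hS, hS', rfl⟩ _ ⟨T, hT, hT', rfl⟩
    obtain ⟨W, hW, hW', h₁, h₂⟩ := AEC.exists_le_le hS hT hS' hT'
    exact ⟨_, ⟨W, hW, hW', rfl⟩, (K.le_map_iff _).2 h₁, (K.le_map_iff _).2 h₂⟩
  have hstrong : ∀ V ∈ D, K.Strong V := by
    rintro _ ⟨S, hS, hS', rfl⟩
    have hmap : ∀ i, K.Strong (S.map (f i).toHom) := fun i => by
      have h := (K.le_map_iff (f i)).2 (K.le_top_iff.2 hS)
      rw [← Hom.range_eq_map] at h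
      exact K.le_top_iff.1 (h.trans (K.le_top_iff.2 (hf i)))
    have hcard : ∀ i, #(S.map (f i).toHom) ≤ K.LS := fun i => mk_image_le.trans hS'
    convert AEC.strong_ultraSub (U := U) hK hN hmap hcard using 1
    ext x
    rw [Substructure.mem_map]
    constructor
    · rintro ⟨m, hm, rfl⟩
      exact ultraMk_mem_ultraSub.2 (.of_forall fun i => Substructure.mem_map_of_mem _ hm)
    · rintro ⟨g, hg, rfl⟩
      have : Nonempty S := K.nonempty _ (K.strong_mod _ _ hS).1
      have : ∀ i, ∃ s : S, g i ∈ S.map (f i).toHom → f i s = g i := fun i => by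
        by_cases h : g i ∈ S.map (f i).toHom
        · obtain ⟨s, hs, hsg⟩ := Substructure.mem_map.1 h
          exact ⟨⟨s, hs⟩, fun _ => hsg⟩
        · exact ⟨Classical.arbitrary S, fun h' => absurd h' h⟩
      choose η hη using this
      obtain ⟨s, hs⟩ := exists_eventually_eq (U := U) (hS'.trans_lt hK) η
      refine ⟨s, s.2, ultraMk_eq.2 ?_⟩
      filter_upwards [hg, hs] with i h₁ h₂
      rw [← h₂]
      exact hη i h₁
  have hmod : K.Mod (⊤ : L.Substructure ((U : Filter X).Product N)) :=
    (K.le_top_iff.2 (hstrong _ hne.some_mem)).mod_right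
  have := (sSup_directed D hne hdir).2 ⊤ hmod fun V hV => K.le_top_iff.2 (hstrong V hV)
  unfold AEC.IsEmb
  convert K.le_top_iff.1 this using 1
  refine le_antisymm ?_ (sSup_le ?_)
  · intro x hx
    obtain ⟨m, rfl⟩ := Hom.mem_range.1 hx
    obtain ⟨S, h₁, h₂, h₃⟩ := AEC.exists_strong_superset hM {m}
      (by simpa using one_le_aleph0.trans K.aleph0_le_LS)
    have : S.map (ultraEmb U f).toHom ≤ sSup D := le_sSup ⟨S, h₁, h₃, rfl⟩
    exact this (Substructure.mem_map_of_mem _ (h₂ rfl))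
  · rintro _ ⟨S, -, -, rfl⟩
    exact Hom.map_le_range

/-! ### The logic `L_{κ,ω}` -/

/-- Satisfaction is invariant under isomorphism. -/
theorem InfFormula.realize_equiv {A B : Type u} [L.Structure A] [L.Structure B] (e : A ≃[L] B) :
    ∀ {n : ℕ} (φ : InfFormula L κ n) (v : Fin n → A),
      φ.Realize B (fun k => e (v k)) ↔ φ.Realize A v
  | _, equal t₁ t₂, v => by
    have h : ∀ t : L.Term _, t.realize (fun k => e (v k)) = e (t.realize v) :=
      fun t => HomClass.realize_term e
    simp only [Realize, h, EmbeddingLike.apply_eq_iff_eq]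
  | _, rel R ts, v => by
    have h : ∀ t : L.Term _, t.realize (fun k => e (v k)) = e (t.realize v) :=
      fun t => HomClass.realize_term e
    simp only [Realize, h]
    exact e.map_rel R _
  | _, neg φ, v => not_congr (realize_equiv e φ v)
  | _, conj _ _ φ, v => forall_congr' fun i => realize_equiv e (φ i) v
  | _, ex φ, v => by
    simp only [Realize]
    have h : ∀ x, (Fin.snoc (fun k => e (v k)) (e x) : Fin _ → B) =
        fun k => e ((Fin.snoc v x : Fin _ → A) k) := fun x => by
      funext k
      refine Fin.lastCases ?_ (fun k => ?_) k <;> simp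
    rw [← e.toEquiv.exists_congr_right]
    refine exists_congr fun x => ?_
    rw [← realize_equiv e φ, ← h]
    rfl

/-- Łoś's theorem for `L_{κ,ω}` and `κ`-complete ultrafilters. -/
theorem InfFormula.realize_ultraMk [∀ i, Nonempty (N i)] :
    ∀ {n : ℕ} (φ : InfFormula L κ n) (v : Fin n → ∀ i, N i),
      φ.Realize ((U : Filter X).Product N) (fun k => ultraMk U (v k)) ↔
        ∀ᶠ i in U, φ.Realize (N i) fun k => v k i
  | _, equal t₁ t₂, v => by
    simp only [Realize]
    rw [realize_term_ultraMk, realize_term_ultraMk]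
    exact ultraMk_eq
  | _, rel R ts, v => by
    simp only [Realize, realize_term_ultraMk]
    exact relMap_ultraMk R fun k i => (ts k).realize fun l => v l i
  | _, neg φ, v => (not_congr (realize_ultraMk φ v)).trans Ultrafilter.eventually_not.symm
  -- This is the case that needs `κ`-completeness.
  | _, conj _ hι φ, v =>
    (forall_congr' fun i => realize_ultraMk (φ i) v).trans
      (Filter.eventually_cardinal_forall hι).symm
  | n, ex φ, v => by
    have h : ∀ x : ∀ i, N i, (Fin.snoc (fun k => ultraMk U (v k)) (ultraMk U x) :
        Fin (n + 1) → (U : Filter X).Product N) =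
        fun k => ultraMk U ((Fin.snoc v x : Fin (n + 1) → ∀ i, N i) k) := fun x => by
      funext k
      refine Fin.lastCases ?_ (fun k => ?_) k <;> simp
    have h' : ∀ (x : ∀ i, N i) i, (fun k => (Fin.snoc v x : Fin (n + 1) → ∀ i, N i) k i) =
        (Fin.snoc (fun k => v k i) (x i) : Fin (n + 1) → N i) := fun x i => by
      funext k
      refine Fin.lastCases ?_ (fun k => ?_) k <;> simp
    simp only [Realize]
    constructor
    · rintro ⟨x, hx⟩
      obtain ⟨x, rfl⟩ := exists_ultraMk x
      rw [h, realize_ultraMk φ] at hx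
      filter_upwards [hx] with i hi
      exact ⟨x i, by rwa [← h']⟩
    · intro hx
      have : ∀ i, ∃ y, (∃ x, φ.Realize (N i) (Fin.snoc (fun k => v k i) x)) →
          φ.Realize (N i) (Fin.snoc (fun k => v k i) y) := fun i => by
        by_cases hi : ∃ x, φ.Realize (N i) (Fin.snoc (fun k => v k i) x)
        · exact ⟨hi.choose, fun _ => hi.choose_spec⟩
        · exact ⟨Classical.arbitrary _, fun h' => absurd h' hi⟩
      choose y hy using this
      refine ⟨ultraMk U y, ?_⟩
      rw [h, realize_ultraMk φ]
      filter_upwards [hx] with i hi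
      rw [h']
      exact hy i hi

/-- By Łoś's theorem, a formula of `F` holds at a diagonal tuple iff it holds at almost all of its
images under the `f i`, hence iff it holds in `M`. -/
theorem AEC.isEmb_ultraEmb_of_theory {T : Set (InfFormula L κ 0)}
    {F : (n : ℕ) → Set (InfFormula L κ n)}
    (hMod : ∀ (M : Type u) [L.Structure M],
      K.Mod M ↔ Nonempty M ∧ ∀ φ ∈ T, φ.Realize M Fin.elim0)
    (hStrong : ∀ (N : Type u) [L.Structure N] (S : L.Substructure N),
      K.Strong S ↔ K.Mod S ∧ K.Mod N ∧ InfFormula.ElemSub F S)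
    {M : Type u} [L.Structure M]
    (f : ∀ i, M ↪[L] N i) (hf : ∀ i, K.IsEmb (f i)) : K.IsEmb (ultraEmb U f) := by
  have hN : ∀ i, K.Mod (N i) := fun i => (K.strong_mod _ _ (hf i)).2
  have : ∀ i, Nonempty (N i) := fun i => K.nonempty _ (hN i)
  obtain ⟨i₀, -⟩ := (Filter.Eventually.of_forall (f := (U : Filter X)) fun _ => trivial).exists
  have hM : K.Mod M := K.mod_iso _ _ (f i₀).equivRange.symm (K.strong_mod _ _ (hf i₀)).1
  refine (hStrong _ _).2 ⟨K.mod_iso _ _ (ultraEmb U f).equivRange hM, (hMod _).2 ⟨?_, ?_⟩, ?_⟩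
  · exact ⟨ultraMk U fun i => Classical.arbitrary _⟩
  · intro φ hφ
    have h := (InfFormula.realize_ultraMk (U := U) φ (Fin.elim0 : Fin 0 → ∀ i, N i)).2
      (.of_forall fun i => by
        convert ((hMod _).1 (hN i)).2 φ hφ using 1)
    convert h using 1
  · intro n φ hφ v
    obtain ⟨m, hm⟩ : ∃ m : Fin n → M, v = fun k => (ultraEmb U f).equivRange (m k) :=
      ⟨fun k => (ultraEmb U f).equivRange.symm (v k), by simp⟩
    subst hm
    rw [InfFormula.realize_equiv]
    have h : ∀ i, φ.Realize (N i) (fun k => f i (m k)) ↔ φ.Realize M m := fun i => by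
      rw [← InfFormula.realize_equiv (f i).equivRange]
      exact (((hStrong _ _).1 (hf i)).2.2 n φ hφ fun k => (f i).equivRange (m k)).symm
    refine Iff.trans ?_ (InfFormula.realize_ultraMk (U := U) φ fun k i => f i (m k)).symm
    simp only [h, Filter.eventually_const]

end Ultraproduct

/-- A class essentially below `κ` is closed under `κ`-complete ultraproducts. -/
theorem AEC.EssentiallyBelow.isEmb_ultraEmb {K : AEC L} {κ : Cardinal.{u}}
    (hK : K.EssentiallyBelow κ) {X : Type u} {U : Ultrafilter X}
    [CardinalInterFilter (U : Filter X) κ] {N : X → Type u} [∀ i, L.Structure (N i)]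
    {M : Type u} [L.Structure M] (f : ∀ i, M ↪[L] N i) (hf : ∀ i, K.IsEmb (f i)) :
    K.IsEmb (ultraEmb U f) := by
  rcases hK with h | ⟨T, F, -, hMod, hStrong⟩
  · exact AEC.isEmb_ultraEmb_of_LS_lt h f hf
  · exact AEC.isEmb_ultraEmb_of_theory hMod hStrong f hf

namespace AEC

variable {K : AEC L}

/-! ### Amalgamation -/

theorem IsEmb.comp {A B C : Type u} [L.Structure A] [L.Structure B] [L.Structure C]
    {g : B ↪[L] C} {f : A ↪[L] B} (hg : K.IsEmb g) (hf : K.IsEmb f) : K.IsEmb (g.comp f) := by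
  have h₁ := (K.le_map_iff g).2 (K.le_top_iff.2 hf)
  rw [← Hom.range_eq_map] at h₁
  have h₂ := K.le_top_iff.1 (h₁.trans (K.le_top_iff.2 hg))
  rw [← Hom.range_comp] at h₂
  exact h₂

/-- Universality places `B₁` in a monster model larger than both; homogeneity over the image of `A`
then places `B₂` there. -/
theorem HasMonsterModel.amalgamation (hC : K.HasMonsterModel) {A B₁ B₂ : Type u}
    [L.Structure A] [L.Structure B₁] [L.Structure B₂] {f₁ : A ↪[L] B₁} {f₂ : A ↪[L] B₂}
    (h₁ : K.IsEmb f₁) (h₂ : K.IsEmb f₂) :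
    ∃ (C : Type u) (_ : L.Structure C) (g₁ : B₁ ↪[L] C) (g₂ : B₂ ↪[L] C),
      K.IsEmb g₁ ∧ K.IsEmb g₂ ∧ ∀ a, g₁ (f₁ a) = g₂ (f₂ a) := by
  obtain ⟨C, _, hC⟩ := hC (Order.succ (max #B₁ #B₂))
  obtain ⟨g₁, hg₁⟩ := hC.universal B₁ (K.strong_mod _ _ h₁).2
    (Order.lt_succ_of_le (le_max_left _ _))
  let e := (g₁.comp f₁).equivRange
  have hemb : K.IsEmb (f₂.comp e.symm.toEmbedding) := by
    have : (f₂.comp e.symm.toEmbedding).toHom.range = f₂.toHom.range := by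
      ext x
      simp only [Hom.mem_range]
      constructor
      · rintro ⟨y, rfl⟩
        exact ⟨e.symm y, rfl⟩
      · rintro ⟨y, rfl⟩
        refine ⟨e y, ?_⟩
        exact congrArg f₂ (e.toEquiv.symm_apply_apply y)
    unfold AEC.IsEmb
    rw [this]
    exact h₂
  obtain ⟨g₂, hg₂, h⟩ := hC.homogeneous _ (hg₁.comp h₁) B₂ _ hemb
    (Order.lt_succ_of_le (le_max_right _ _))
  refine ⟨C, _, g₁, g₂, hg₁, hg₂, fun a => ?_⟩
  exact (h (e a)).symm.trans (congrArg (fun x => g₂ (f₂ x)) (e.toEquiv.symm_apply_apply a))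

/-- The two witnesses are amalgamated over the middle model `q.N`. -/
theorem Pretype.AT.trans (hC : K.HasMonsterModel) {M : Type u} [L.Structure M] {I : Type u}
    {p q r : K.Pretype M I} (h₁ : p.AT q) (h₂ : q.AT r) : p.AT r := by
  obtain ⟨N₁, _, f₁, g₁, hf₁, hg₁, hm₁, ha₁⟩ := h₁
  obtain ⟨N₂, _, f₂, g₂, hf₂, hg₂, hm₂, ha₂⟩ := h₂
  obtain ⟨C, _, k₁, k₂, hk₁, hk₂, h⟩ := hC.amalgamation hg₁ hf₂
  refine ⟨C, _, k₁.comp f₁, k₂.comp g₂, hk₁.comp hf₁, hk₂.comp hg₂, fun m => ?_, fun i => ?_⟩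
  · simp only [Embedding.comp_apply, hm₁, h, hm₂]
  · simp only [Embedding.comp_apply, ha₁, h, ha₂]

theorem Pretype.AT.of_transGen (hC : K.HasMonsterModel) {M : Type u} [L.Structure M]
    {I : Type u} {p q : K.Pretype M I} (h : Relation.TransGen Pretype.AT p q) : p.AT q := by
  induction h with
  | single h => exact h
  | tail _ h ih => exact ih.trans hC h

/-! ### Increasing unions of length `κ` -/

/-- The members of an increasing, not necessarily continuous, chain are strong in its union. -/
theorem strong_of_iUnion_eq_univ {M ι : Type u} [L.Structure M] [LinearOrder ι] [Nonempty ι]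
    {S : ι → L.Substructure M} (hS : ∀ i j, i ≤ j → K.Le (S i) (S j))
    (hU : (⋃ i, (S i : Set M)) = Set.univ) (i : ι) : K.Strong (S i) := by
  -- Without continuity the chain axiom does not apply, but the range is a directed system.
  have hdir : DirectedOn K.Le (range S) := by
    rintro _ ⟨i, rfl⟩ _ ⟨j, rfl⟩
    exact ⟨_, ⟨max i j, rfl⟩, hS _ _ (le_max_left _ _), hS _ _ (le_max_right _ _)⟩
  have htop : sSup (range S) = ⊤ := by
    refine eq_top_iff.2 fun x _ => ?_
    obtain ⟨i, hi⟩ := mem_iUnion.1 (hU ▸ mem_univ x)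
    have hle : S i ≤ sSup (range S) := le_sSup (mem_range_self i)
    exact hle hi
  have := (sSup_directed _ (range_nonempty S) hdir).1 _ (mem_range_self i)
  rw [htop] at this
  exact K.le_top_iff.1 this

/-- The ultrafilter of a measurable cardinal contains all final segments. -/
theorem eventually_le_of_nonprincipal {κ : Cardinal.{u}} {X : Type u} {U : Ultrafilter X}
    [CardinalInterFilter (U : Filter X) κ] (hU : ∀ x : X, {x} ∉ U) (e : X ≃ κ.ord.ToType)
    (a : κ.ord.ToType) : ∀ᶠ x in U, a ≤ e x := by
  -- The complement of a set of size less than `κ` is an intersection of fewer than `κ` complements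
  -- of points, all in `U`.
  have hcard : #{x | e x < a} < κ := by
    have h₁ : #{x | e x < a} ≤ #(Iio a) :=
      mk_le_of_injective (f := fun x => ⟨e x.1, x.2⟩) fun x y h =>
        Subtype.ext (e.injective (congrArg Subtype.val h))
    exact h₁.trans_lt ((mk_Iio_lt a (by simp)).trans_eq (mk_ord_toType κ))
  have h : ∀ᶠ x in U, ∀ y (_ : y ∈ {x | e x < a}), x ≠ y :=
    (Filter.eventually_cardinal_ball hcard).2 fun y _ => Ultrafilter.eventually_not.2 (hU y)
  filter_upwards [h] with x hx
  exact not_lt.1 fun hlt => hx x hlt rfl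

/-- Over an increasing union of length `κ`, types that agree on each stage are equal. -/
theorem GaloisType.eq_of_forall_restrict_eq {κ : Cardinal.{u}} (hκ : IsMeasurableCardinal κ)
    (hK : K.EssentiallyBelow κ) (hC : K.HasMonsterModel) {M I : Type u} [L.Structure M]
    {S : κ.ord.ToType → L.Substructure M} {J : κ.ord.ToType → Set I}
    (hS : ∀ a b, a ≤ b → K.Le (S a) (S b)) (hSU : (⋃ a, (S a : Set M)) = Set.univ)
    (hJ : Monotone J) (hJU : (⋃ a, J a) = Set.univ) {p q : K.GaloisType M I}
    (h : ∀ a (hs : K.Strong (S a)),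
      (p.restrictIndex (J a)).restrict hs = (q.restrictIndex (J a)).restrict hs) :
    p = q := by
  obtain ⟨hω, X, U, hX, hUκ, hU⟩ := hκ
  obtain ⟨e⟩ : Nonempty (X ≃ κ.ord.ToType) := Cardinal.eq.1 (by rw [hX, mk_ord_toType])
  have : Nonempty κ.ord.ToType := nonempty_ord_toType (aleph0_pos.trans hω).ne'
  have hs : ∀ a, K.Strong (S a) := strong_of_iUnion_eq_univ hS hSU
  induction p using Quotient.ind with | _ P
  induction q using Quotient.ind with | _ Q
  have hAT : ∀ a, ((P.restrictIndex (J a)).restrict (hs a)).AT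
      ((Q.restrictIndex (J a)).restrict (hs a)) := fun a =>
    .of_transGen hC (Quotient.exact (h a (hs a)))
  choose N str f g hf hg hm ha using fun x => hAT (e x)
  -- Each `f x` is defined on all of `P.N`, and each `g x` on all of `Q.N`; only their agreement is
  -- limited to stage `e x`. Every `m` and `i` has entered by some stage `a`, and `a ≤ e x` for
  -- almost all `x`.
  refine Quotient.sound (.single ⟨(U : Filter X).Product N, inferInstance,
    ultraEmb U f, ultraEmb U g, hK.isEmb_ultraEmb f hf, hK.isEmb_ultraEmb g hg,
    fun m => ?_, fun i => ?_⟩)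
  · obtain ⟨a, hma⟩ := mem_iUnion.1 (hSU ▸ mem_univ m)
    refine ultraMk_eq.2 ?_
    filter_upwards [eventually_le_of_nonprincipal hU e a] with x hx
    exact hm x ⟨m, (hS _ _ hx).1 hma⟩
  · obtain ⟨a, hia⟩ := mem_iUnion.1 (hJU ▸ mem_univ i)
    refine ultraMk_eq.2 ?_
    filter_upwards [eventually_le_of_nonprincipal hU e a] with x hx
    exact ha x ⟨i, hJ hx hia⟩

/-! ### Resolutions -/

theorem mk_iUnion_lt_of_lt_cof {ι Y : Type u} {lam : Cardinal.{u}} (hω : ℵ₀ ≤ lam)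
    (hι : #ι < lam.ord.cof) {B : ι → Set Y} (hB : ∀ i, #(B i) < lam) : #(⋃ i, B i) < lam := by
  refine (mk_iUnion_le B).trans_lt (mul_lt_of_lt hω ?_ (iSup_lt_of_lt_cof_ord hι hB))
  exact hι.trans_le (Ordinal.cof_ord_le lam)

/-- The pieces are initial segments of an enumeration of `Y` in type `lam`, cut at the points of a
cofinal set of size `κ`. That set is indexed by an arbitrary bijection, so the pieces need not
increase with `a`. -/
theorem exists_iUnion_eq_univ {Y : Type u} {κ lam : Cardinal.{u}} (hω : ℵ₀ ≤ lam)
    (hcof : lam.ord.cof = κ) (hY : #Y = lam) :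
    ∃ A : κ.ord.ToType → Set Y, (∀ a, #(A a) < lam) ∧ (⋃ a, A a) = Set.univ := by
  obtain ⟨ρ⟩ : Nonempty (Y ≃ lam.ord.ToType) := Cardinal.eq.1 (by rw [hY, mk_ord_toType])
  obtain ⟨s, hs, hsκ⟩ := Order.exists_cof_eq lam.ord.ToType
  rw [Ordinal.cof_toType, hcof] at hsκ
  obtain ⟨e⟩ : Nonempty (κ.ord.ToType ≃ s) := Cardinal.eq.1 (by rw [hsκ, mk_ord_toType])
  have := Cardinal.noMaxOrder hω
  refine ⟨fun a => {y | ρ y ≤ e a}, fun a => ?_, eq_univ_of_forall fun y => ?_⟩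
  · obtain ⟨j, hj⟩ := exists_gt (e a : lam.ord.ToType)
    have h₁ : #{y | ρ y ≤ e a} ≤ #(Iio j) :=
      mk_le_of_injective (f := fun y => ⟨ρ y.1, y.2.trans_lt hj⟩) fun x y h =>
        Subtype.ext (ρ.injective (congrArg Subtype.val h))
    exact h₁.trans_lt ((mk_Iio_lt j (by simp)).trans_eq (mk_ord_toType lam))
  · obtain ⟨x, hx, hyx⟩ := hs (ρ y)
    exact mem_iUnion.2 ⟨e.symm ⟨x, hx⟩, by simpa using hyx⟩

/-- Recursion on `a`: take a strong submodel containing `A a` and all earlier stages. There are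
fewer than `κ = cf lam` of these, so their union is smaller than `lam`, and `LS(K) < lam` keeps the
submodel small. Coherence turns inclusions into `≺`; continuity at limits is not needed. -/
theorem exists_strong_resolution {M : Type u} [L.Structure M] {κ lam : Cardinal.{u}}
    (hcof : lam.ord.cof = κ) (hlam : K.LS < lam) (hM : K.Mod M) (hMcard : #M = lam) :
    ∃ S : κ.ord.ToType → L.Substructure M, (∀ a, K.Strong (S a) ∧ #(S a) < lam) ∧
      (∀ a b, a ≤ b → K.Le (S a) (S b)) ∧ (⋃ a, (S a : Set M)) = Set.univ := by
  have hω : ℵ₀ ≤ lam := K.aleph0_le_LS.trans hlam.le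
  obtain ⟨A, hA, hAU⟩ := exists_iUnion_eq_univ hω hcof hMcard
  let Small := {S : L.Substructure M // K.Strong S ∧ #S < lam}
  have step : ∀ (a : κ.ord.ToType) (F : ∀ b, b < a → Small), ∃ S : Small,
      A a ⊆ S.1 ∧ ∀ b hb, (F b hb).1 ≤ S.1 := by
    intro a F
    have hι : #(Iio a) < lam.ord.cof :=
      hcof.symm ▸ (mk_Iio_lt a (by simp)).trans_eq (mk_ord_toType κ)
    have hB := mk_iUnion_lt_of_lt_cof hω hι (B := fun b : Iio a => ((F b.1 b.2).1 : Set M))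
      fun b => (F b.1 b.2).2.2
    obtain ⟨S, h₁, h₂, h₃⟩ := K.isLSBound_LS.2 M hM
      (A a ∪ ⋃ b : Iio a, ((F b.1 b.2).1 : Set M))
    refine ⟨⟨S, h₁, h₃.trans_lt (add_lt_of_lt hω ?_ hlam)⟩, fun x hx => h₂ (.inl hx),
      fun b hb x hx => h₂ (.inr (mem_iUnion.2 ⟨⟨b, hb⟩, hx⟩))⟩
    exact (mk_union_le _ _).trans_lt (add_lt_of_lt hω (hA a) hB)
  choose G hGA hG using step
  have wf : WellFounded ((· < ·) : κ.ord.ToType → κ.ord.ToType → Prop) := wellFounded_lt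
  let S : κ.ord.ToType → Small := wf.fix G
  have hS : ∀ a, S a = G a fun b _ => S b := fun a => wf.fix_eq G a
  refine ⟨fun a => (S a).1, fun a => (S a).2, fun a b hab => ?_, ?_⟩
  · refine K.coherence _ _ _ (S a).2.1 (S b).2.1 ?_
    rcases hab.eq_or_lt with rfl | hlt
    · exact le_rfl
    · beta_reduce
      rw [hS b]
      exact hG b (fun c _ => S c) a hlt
  · refine eq_univ_of_univ_subset (hAU ▸ iUnion_mono fun a => ?_)
    beta_reduce
    rw [hS a]
    exact hGA a _

theorem GaloisType.restrict_restrictIndex {M I : Type u} [L.Structure M] (p : K.GaloisType M I)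
    {S : L.Substructure M} (hS : K.Strong S) (J : Set I) :
    (p.restrictIndex J).restrict hS = (p.restrict hS).restrictIndex J := by
  induction p using Quotient.ind
  rfl

/-! ### Tameness, type shortness and the main theorem -/

theorem fullyTame_of_measurable {κ lam : Cardinal.{u}} (hκ : IsMeasurableCardinal κ)
    (hK : K.EssentiallyBelow κ) (hC : K.HasMonsterModel) (hcof : lam.ord.cof = κ)
    (hlam : K.LS < lam) : K.FullyTame lam lam := by
  intro I M _ hM hMcard p q hpq
  obtain ⟨S, hS, hle, hU⟩ := exists_strong_resolution hcof hlam hM hMcard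
  by_contra! h
  have : Nonempty κ.ord.ToType := nonempty_ord_toType (aleph0_pos.trans hκ.1).ne'
  refine hpq (GaloisType.eq_of_forall_restrict_eq (J := fun _ => Set.univ) hκ hK hC hle hU
    monotone_const (iUnion_const _) fun a hs => ?_)
  rw [GaloisType.restrict_restrictIndex, GaloisType.restrict_restrictIndex, h _ hs (hS a).2]

theorem fullyTypeShort_of_measurable {κ lam : Cardinal.{u}} (hκ : IsMeasurableCardinal κ)
    (hK : K.EssentiallyBelow κ) (hC : K.HasMonsterModel) (hcof : lam.ord.cof = κ)
    (hlam : K.LS < lam) : K.FullyTypeShort lam lam := by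
  intro I M _ hM hI p q hpq
  have hω : ℵ₀ ≤ lam := K.aleph0_le_LS.trans hlam.le
  obtain ⟨A, hA, hAU⟩ := exists_iUnion_eq_univ hω hcof hI
  by_contra! h
  have : Nonempty κ.ord.ToType := nonempty_ord_toType (aleph0_pos.trans hκ.1).ne'
  have hκω : ℵ₀ ≤ κ := hκ.1.le
  have := Cardinal.noMaxOrder hκω
  -- The model is constant. Unions over `b ≤ a` make the pieces of `I` increasing and, being unions
  -- of fewer than `κ = cf lam` sets, keep them smaller than `lam`.
  refine hpq (GaloisType.eq_of_forall_restrict_eq (S := fun _ => ⊤)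
    (J := fun a => ⋃ b : Iic a, A b) hκ hK hC
    (fun _ _ _ => K.le_top_iff.2 (K.strong_refl M hM)) (iUnion_const _) ?_ ?_ fun a hs => ?_)
  · exact fun a b hab => iUnion_subset fun c =>
      subset_iUnion (fun c : Iic b => A c) ⟨c, c.2.trans hab⟩
  · refine eq_univ_of_univ_subset (hAU ▸ iUnion_mono fun a => ?_)
    exact subset_iUnion (fun c : Iic a => A c) ⟨a, self_mem_Iic⟩
  · rw [h]
    refine mk_iUnion_lt_of_lt_cof hω ?_ fun b => hA b
    obtain ⟨j, hj⟩ := exists_gt a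
    rw [hcof]
    exact (mk_le_mk_of_subset (Iic_subset_Iio.2 hj)).trans_lt
      ((mk_Iio_lt j (by simp)).trans_eq (mk_ord_toType κ))

end AEC
end AECType

theorem mainTheorem6 {L : FirstOrder.Language.{u, u}} (K : AECType.AEC L) (κ : Cardinal.{u})
    (hκ : AECType.IsMeasurableCardinal κ) (hK : K.EssentiallyBelow κ)
    (hC : K.HasMonsterModel) :
    (∀ (M I : Type u) [L.Structure M]
        (Mseq : Iio κ.ord → L.Substructure M) (Iseq : Iio κ.ord → Set I),
        (∀ α β, α ≤ β → K.Le (Mseq α) (Mseq β)) → (⋃ α, (Mseq α : Set M)) = Set.univ →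
        Monotone Iseq → (⋃ α, Iseq α) = Set.univ →
        ∀ p q : K.GaloisType M I, p ≠ q →
          ∃ (α₀ : Iio κ.ord) (h : K.Strong (Mseq α₀)),
            (p.restrictIndex (Iseq α₀)).restrict h ≠ (q.restrictIndex (Iseq α₀)).restrict h) ∧
      ∀ lam : Cardinal.{u}, lam.ord.cof = κ → K.LS < lam →
        K.FullyTame lam lam ∧ K.FullyTypeShort lam lam := by
  refine ⟨fun M I _ Mseq Iseq hM hMU hI hIU p q hpq => ?_, fun lam hcof hlam =>
    ⟨AECType.AEC.fullyTame_of_measurable hκ hK hC hcof hlam,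
      AECType.AEC.fullyTypeShort_of_measurable hκ hK hC hcof hlam⟩⟩
  by_contra! h
  -- `Iio κ.ord` lives one universe too high to index the chain, so it is replaced by
  -- `κ.ord.ToType`.
  let o : κ.ord.ToType ≃o Iio κ.ord := Ordinal.ToType.mk.symm
  refine hpq (AECType.AEC.GaloisType.eq_of_forall_restrict_eq (S := fun a => Mseq (o a))
    (J := fun a => Iseq (o a)) hκ hK hC (fun a b hab => hM _ _ (o.monotone hab)) ?_
    (hI.comp o.monotone) ?_ fun a hs => h _ hs)
  · rw [← hMU]
    exact o.surjective.iUnion_comp fun α => (Mseq α : Set M)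
  · rw [← hIU]
    exact o.surjective.iUnion_comp Iseq
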